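/- Let $A\in\mathbb R^{n\times n}$, $B\in\mathbb R^{n\times p}$, let $Q\in\mathbb R^{n\times n}$, $R\in\mathbb R^{p\times p}$ be symmetric positive definite, and let $\Sigma_w\in\mathbb R^{n\times n}$, $\Sigma_\sigma\in\mathbb R^{p\times p}$ be symmetric positive semidefinite matrices such that $\Sigma_{\bar w}:=\Sigma_w+B\Sigma_\sigma B^T$ is positive definite. Let $q\in\mathbb R^n\setminus\{0\}$, $\epsilon>0$, $\delta>0$. Let $$\mathcal K=\{K\in\mathbb R^{p\times n}:\rho(A-BK)<1\},$$ where $\rho$ is the spectral radius, and assume that $(A,B)$ is stabilizable, i.e. $\mathcal K\neq\emptyset$. For $K\in\mathcal K$ let $\Sigma_K$ be the unique solution of $\Sigma_K=\Sigma_{\bar w}+(A-BK)\Sigma_K(A-BK)^T$, let $x$ be distributed according to the unique stationary law of the closed-loop system $x_{k+1}=(A-BK)x_k+\bar w_k$, where the $\bar w_k\sim\mathcal N(0,\Sigma_{\bar w})$ are i.i.d. and $\bar w_k$ is independent of $x_k$, and put $$J(K)=\operatorname{tr}\big((Q+K^TRK)\Sigma_K\big)+\operatorname{tr}(R\Sigma_\sigma),\qquad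 J_c(K)=\mathrm E\left[\Phi^c\!\left(\frac{\epsilon-q^T(A-BK)x}{\sqrt{q^T\Sigma_{\bar w}q}}\right)\right],\qquad \Phi^c(a)=\frac1{\sqrt{2\pi}}\int_a^\infty e^{-z^2/2}\,dz,$$ $$\mathcal L(K,\lambda)=J(K)+\lambda\,(J_c(K)-\delta).$$ Then for every $\lambda>0$ and every $\zeta\in\mathbb R$ the sublevel set $\mathcal K_\zeta=\{K\in\mathcal K:\mathcal L(K,\lambda)\le\zeta\}$ is compact, and $\mathcal L(\cdot,\lambda)$ is $L$-smooth on $\mathcal K_\zeta$ for some constant $L>0$ depending only on the problem data ($A,B,Q,R,\Sigma_w,\Sigma_\sigma,q,\epsilon,\delta,\lambda$) and $\zeta$. That is, $\mathcal L(\cdot,\lambda)$ is differentiable at every point of $\mathcal K_\zeta$ and, with $\|\cdot\|$ the Frobenius norm, for all $K,K'\in\mathcal K_\zeta$, $$\|\nabla_K\mathcal L(K',\lambda)-\nabla_K\mathcal L(K,\lambda)\|\le L\|K'-K\|,$$ $$\mathcal L(K',\lambda)-\mathcal L(K,\lambda)\le\operatorname{tr}\big(\nabla_K\mathcal L(K,\lambda)^T(K'-K)\big)+\frac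 L2\|K'-K\|^2 .$$ -/

import Mathlib

open scoped Matrix
open MeasureTheory ProbabilityTheory

/-! Matrices carry the Frobenius norm, whose topology is the entrywise one. -/
attribute [local instance] Matrix.frobeniusNormedAddCommGroup Matrix.frobeniusNormedSpace

noncomputable section

/-- The data of a chance-constrained linear quadratic regulator with state dimension `n` and input
dimension `p`: dynamics `x⁺ = A x + B u + w`, stage cost `xᵀ Q x + uᵀ R u`, process noise
`w ∼ N(0, Sw)`, exploration noise `N(0, Su)` of the policy `u = -K x + σ`, risky event
`qᵀ x ≥ ε` and threshold `δ` for its probability. -/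
structure RiskLQR (n p : ℕ) where
  A : Matrix (Fin n) (Fin n) ℝ
  B : Matrix (Fin n) (Fin p) ℝ
  Q : Matrix (Fin n) (Fin n) ℝ
  R : Matrix (Fin p) (Fin p) ℝ
  Sw : Matrix (Fin n) (Fin n) ℝ
  Su : Matrix (Fin p) (Fin p) ℝ
  q : Fin n → ℝ
  ε : ℝ
  δ : ℝ

namespace RiskLQR

variable {n p : ℕ} (P : RiskLQR n p)

/-- Closed-loop matrix `A - B K`. -/
def closedLoop (K : Matrix (Fin p) (Fin n) ℝ) : Matrix (Fin n) (Fin n) ℝ := P.A - P.B * K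

/-- Stabilizing gains: the spectral radius of `A - B K` (over its complex eigenvalues) is `< 1`. -/
def stabilizing : Set (Matrix (Fin p) (Fin n) ℝ) :=
  {K | spectralRadius ℂ ((P.closedLoop K).map (algebraMap ℝ ℂ)) < 1}

/-- Covariance `Sw + B Su Bᵀ` of the aggregated noise `w + B σ`. -/
def noiseCov : Matrix (Fin n) (Fin n) ℝ := P.Sw + P.B * P.Su * P.Bᵀ

open Classical in
/-- The solution `S` of the Lyapunov equation `S = noiseCov + (A - B K) S (A - B K)ᵀ`; it is unique
when `K` is stabilizing. (The value is `0` if there is no solution.) -/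
def stateCov (K : Matrix (Fin p) (Fin n) ℝ) : Matrix (Fin n) (Fin n) ℝ :=
  if h : ∃ S, S = P.noiseCov + P.closedLoop K * S * (P.closedLoop K)ᵀ then h.choose else 0

/-- `μ` is a stationary law of the closed loop `x⁺ = (A - B K) x + w̄`, where
`w̄ ∼ N(0, noiseCov)` is independent of `x`. -/
def IsStationaryLaw (K : Matrix (Fin p) (Fin n) ℝ)
    (μ : Measure (EuclideanSpace ℝ (Fin n))) : Prop :=
  IsProbabilityMeasure μ ∧
    (μ.map (Matrix.toEuclideanCLM (𝕜 := ℝ) (P.closedLoop K))) ∗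
      multivariateGaussian 0 P.noiseCov = μ

open Classical in
/-- The stationary law of the closed-loop state; it exists and is unique when `K` is stabilizing.
(The value is `0` if there is none.) -/
def stationaryLaw (K : Matrix (Fin p) (Fin n) ℝ) : Measure (EuclideanSpace ℝ (Fin n)) :=
  if h : ∃ μ, P.IsStationaryLaw K μ then h.choose else 0

/-- Gaussian tail function `(2π)^(-1/2) ∫_a^∞ exp(-z²/2) dz`. -/
def gaussianTail (a : ℝ) : ℝ :=
  1 / √(2 * Real.pi) * ∫ z in Set.Ioi a, Real.exp (-(z ^ 2) / 2)

/-- The normalized threshold `(ε - qᵀ (A - B K) x) / √(qᵀ noiseCov q)`. -/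
def normThreshold (K : Matrix (Fin p) (Fin n) ℝ) (x : EuclideanSpace ℝ (Fin n)) : ℝ :=
  (P.ε - P.q ⬝ᵥ (P.closedLoop K *ᵥ x.ofLp)) / √(P.q ⬝ᵥ (P.noiseCov *ᵥ P.q))

/-- Quadratic cost `J(K) = tr((Q + Kᵀ R K) Σ_K) + tr(R Su)`. -/
def cost (K : Matrix (Fin p) (Fin n) ℝ) : ℝ :=
  ((P.Q + Kᵀ * P.R * K) * P.stateCov K).trace + (P.R * P.Su).trace

/-- Risk `J_c(K)`: the stationary expectation of the one-step conditional probability of the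
risky event. -/
def risk (K : Matrix (Fin p) (Fin n) ℝ) : ℝ :=
  ∫ x, gaussianTail (P.normThreshold K x) ∂(P.stationaryLaw K)

/-- The Lagrangian `J(K) + lam (J_c(K) - δ)`. -/
def lagrangian (lam : ℝ) (K : Matrix (Fin p) (Fin n) ℝ) : ℝ :=
  P.cost K + lam * (P.risk K - P.δ)

/-- The sublevel set of the Lagrangian within the stabilizing gains. -/
def sublevel (lam ζ : ℝ) : Set (Matrix (Fin p) (Fin n) ℝ) :=
  {K | K ∈ P.stabilizing ∧ P.lagrangian lam K ≤ ζ}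

end RiskLQR

/-- The gradient matrix of `f` at `K`, i.e. the matrix of partial derivatives in the entries. -/
def gradMatrix {p n : ℕ} (f : Matrix (Fin p) (Fin n) ℝ → ℝ) (K : Matrix (Fin p) (Fin n) ℝ) :
    Matrix (Fin p) (Fin n) ℝ :=
  Matrix.of fun i j => fderiv ℝ f K (Matrix.single i j 1)

/-- `f` is `L`-smooth on the (not necessarily convex) set `s`: it is differentiable at the points
of `s`, its gradient is `L`-Lipschitz on `s` in the Frobenius norm, and the quadratic upper bound
with constant `L` holds between any two points of `s`. -/
structure LSmoothOn {p n : ℕ} (L : ℝ) (f : Matrix (Fin p) (Fin n) ℝ → ℝ)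
    (s : Set (Matrix (Fin p) (Fin n) ℝ)) : Prop where
  differentiableAt : ∀ K ∈ s, DifferentiableAt ℝ f K
  lipschitz : ∀ K ∈ s, ∀ K' ∈ s, ‖gradMatrix f K' - gradMatrix f K‖ ≤ L * ‖K' - K‖
  upper_bound : ∀ K ∈ s, ∀ K' ∈ s,
    f K' - f K ≤ ((gradMatrix f K)ᵀ * (K' - K)).trace + L / 2 * ‖K' - K‖ ^ 2

end

/-! Write `A_K` for the closed loop, `W` for `noiseCov`, `Σ_K` for the Lyapunov solution. Risk: the
stationary law is `N(0, Σ_K)`, and the integrand of `J_c` is the conditional probability that the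
next state crosses `ε`. The next state is stationary too, so `J_c(K) = Φᶜ(ε / √(qᵀ Σ_K q))`
(`risk_eq_gaussianTail`). Smoothness: `Σ_K` comes from inverting a linear operator that is
polynomial in `K`, and `qᵀ Σ_K q ≥ qᵀ W q > 0`; hence the Lagrangian is `C^∞` on the open set of
stabilizing gains. Compactness: the risk is nonnegative, so a bound on the Lagrangian bounds the
cost, and with it `‖K‖²` and `tr Σ_K`. Since `W` is definite, `tr Σ_K` dominates `∑ ‖A_K ^ i‖²`. A
uniform bound on these sums is a closed condition that forces stability, so sublevel sets stay away
from the boundary of the stabilizing set (`exists_isCompact_sublevel_subset`). `L`-smoothness: a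
sublevel set need not be convex, so segments may leave it. A cutoff replaces the Lagrangian by a
compactly supported `C²` function on the whole space, whose derivative is globally Lipschitz. -/

open Filter Topology

/-! ### Frobenius estimates; spectral radius and powers -/

namespace Matrix

variable {l m n : Type*} [Fintype l] [Fintype m] [Fintype n]

theorem frobenius_norm_sq_eq_trace (M : Matrix m n ℝ) : ‖M‖ ^ 2 = (M * Mᵀ).trace := by
  have h0 : 0 ≤ ∑ i, ∑ j, ‖M i j‖ ^ (2 : ℝ) := by positivity
  rw [frobenius_norm_def, ← Real.rpow_natCast, ← Real.rpow_mul h0]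
  simp [trace, mul_apply, sq]

theorem PosSemidef.exists_eq_mul_transpose {S : Matrix n n ℝ} (hS : S.PosSemidef) :
    ∃ D : Matrix n n ℝ, S = D * Dᵀ := by
  classical
  open scoped MatrixOrder in
  obtain ⟨B, hB⟩ := CStarAlgebra.nonneg_iff_eq_star_mul_self.mp hS.nonneg
  exact ⟨Bᵀ, by simpa [star_eq_conjTranspose] using hB⟩

theorem PosSemidef.trace_mul_mul_transpose_nonneg {S : Matrix n n ℝ} (hS : S.PosSemidef)
    (M : Matrix m n ℝ) : 0 ≤ (M * S * Mᵀ).trace := by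
  obtain ⟨D, rfl⟩ := hS.exists_eq_mul_transpose
  have : M * (D * Dᵀ) * Mᵀ = (M * D) * (M * D)ᵀ := by
    simp only [transpose_mul, Matrix.mul_assoc]
  rw [this, ← frobenius_norm_sq_eq_trace]
  positivity

/-- A positive definite quadratic form dominates a multiple of the squared Frobenius norm. -/
theorem PosDef.exists_le_trace_mul_mul_transpose {W : Matrix n n ℝ} (hW : W.PosDef) :
    ∃ c : ℝ, 0 < c ∧ ∀ M : Matrix m n ℝ, c * ‖M‖ ^ 2 ≤ (M * W * Mᵀ).trace := by
  classical
  obtain ⟨D, rfl⟩ := hW.posSemidef.exists_eq_mul_transpose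
  have hD : IsUnit D.det := by
    have h := (isUnit_iff_isUnit_det _).1 hW.isUnit
    rw [det_mul] at h
    exact isUnit_of_mul_isUnit_left h
  have key (M : Matrix m n ℝ) : ‖M‖ ≤ ‖M * D‖ * ‖D⁻¹‖ := by
    conv_lhs => rw [← mul_nonsing_inv_cancel_right D M hD]
    exact frobenius_norm_mul _ _
  refine ⟨(‖D⁻¹‖ ^ 2 + 1)⁻¹, by positivity, fun M => ?_⟩
  have e : M * (D * Dᵀ) * Mᵀ = (M * D) * (M * D)ᵀ := by
    simp only [transpose_mul, Matrix.mul_assoc]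
  rw [e, ← frobenius_norm_sq_eq_trace, inv_mul_le_iff₀ (by positivity)]
  calc ‖M‖ ^ 2 ≤ (‖M * D‖ * ‖D⁻¹‖) ^ 2 := by gcongr; exact key M
    _ ≤ (‖D⁻¹‖ ^ 2 + 1) * ‖M * D‖ ^ 2 := by nlinarith [sq_nonneg ‖M * D‖]

theorem isBoundedBilinearMap_mul :
    IsBoundedBilinearMap ℝ (fun x : Matrix l m ℝ × Matrix m n ℝ => x.1 * x.2) where
  add_left _ _ _ := Matrix.add_mul _ _ _
  smul_left _ _ _ := Matrix.smul_mul _ _ _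
  add_right _ _ _ := Matrix.mul_add _ _ _
  smul_right _ _ _ := Matrix.mul_smul _ _ _
  bound := ⟨1, one_pos, fun x y => by simpa using frobenius_norm_mul x y⟩

variable [DecidableEq n]

/-- Gelfand's formula: for `r` strictly between the spectral radius and `1`, eventually `‖A ^ k‖ ≤ r
^ k`. -/
theorem tendsto_pow_of_spectralRadius_lt_one {A : Matrix n n ℝ}
    (hA : spectralRadius ℂ (A.map (algebraMap ℝ ℂ)) < 1) :
    Tendsto (fun k : ℕ => A ^ k) atTop (𝓝 0) := by
  let _ := frobeniusNormedRing (m := n) (α := ℂ)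
  let _ := frobeniusNormedAlgebra (m := n) (R := ℂ) (α := ℂ)
  have : CompleteSpace (Matrix n n ℂ) := FiniteDimensional.complete ℂ _
  have hpow (k : ℕ) : ‖(A.map (algebraMap ℝ ℂ)) ^ k‖₊ = ‖A ^ k‖₊ := by
    rw [← Matrix.map_pow]
    exact frobenius_nnnorm_map_eq _ _ (by simp)
  have hG := spectrum.pow_nnnorm_pow_one_div_tendsto_nhds_spectralRadius (A.map (algebraMap ℝ ℂ))
  obtain ⟨r, hr, hr1⟩ := ENNReal.lt_iff_exists_nnreal_btwn.1 hA
  have hr1' : r < 1 := by exact_mod_cast hr1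
  refine tendsto_zero_iff_norm_tendsto_zero.2 ?_
  refine squeeze_zero' (Eventually.of_forall fun _ => norm_nonneg _) ?_
    (tendsto_pow_atTop_nhds_zero_of_lt_one r.2 (by exact_mod_cast hr1'))
  filter_upwards [hG.eventually (gt_mem_nhds hr), eventually_gt_atTop 0] with k hk hk0
  have hk' := hk.le
  rw [hpow, one_div, ENNReal.rpow_inv_le_iff (by positivity), ENNReal.rpow_natCast] at hk'
  have : ‖A ^ k‖₊ ≤ r ^ k := by exact_mod_cast hk'
  exact_mod_cast this

/-- A test on a single power is an open condition on `A`, which makes stability open. The factor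
`‖1‖` stays because the Frobenius norm of the identity is `√n`. -/
theorem spectralRadius_lt_one_of_norm_pow_lt {A : Matrix n n ℝ} {k : ℕ}
    (hk : ‖A ^ (k + 1)‖ * ‖(1 : Matrix n n ℝ)‖ < 1) :
    spectralRadius ℂ (A.map (algebraMap ℝ ℂ)) < 1 := by
  let _ := frobeniusNormedRing (m := n) (α := ℂ)
  let _ := frobeniusNormedAlgebra (m := n) (R := ℂ) (α := ℂ)
  have : CompleteSpace (Matrix n n ℂ) := FiniteDimensional.complete ℂ _
  have hpow : ‖(A.map (algebraMap ℝ ℂ)) ^ (k + 1)‖₊ = ‖A ^ (k + 1)‖₊ := by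
    rw [← Matrix.map_pow]
    exact frobenius_nnnorm_map_eq _ _ (by simp)
  have hone : ‖(1 : Matrix n n ℂ)‖₊ = ‖(1 : Matrix n n ℝ)‖₊ := by
    rw [← Matrix.map_one (algebraMap ℝ ℂ) (map_zero _) (map_one _)]
    exact frobenius_nnnorm_map_eq _ _ (by simp)
  refine (spectrum.spectralRadius_le_pow_nnnorm_pow_one_div ℂ _ k).trans_lt ?_
  rw [hpow, hone, ← ENNReal.mul_rpow_of_nonneg _ _ (by positivity)]
  have hk' : ‖A ^ (k + 1)‖₊ * ‖(1 : Matrix n n ℝ)‖₊ < 1 := by exact_mod_cast hk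
  exact ENNReal.rpow_lt_one (by exact_mod_cast hk') (by positivity)

theorem exists_norm_pow_lt_of_tendsto_pow {A : Matrix n n ℝ}
    (hA : Tendsto (fun k : ℕ => A ^ k) atTop (𝓝 0)) :
    ∃ k : ℕ, ‖A ^ (k + 1)‖ * ‖(1 : Matrix n n ℝ)‖ < 1 := by
  have h1 : Tendsto (fun k : ℕ => ‖A ^ (k + 1)‖ * ‖(1 : Matrix n n ℝ)‖) atTop (𝓝 0) := by
    have h2 := (hA.comp (tendsto_add_atTop_nat 1)).norm.mul_const ‖(1 : Matrix n n ℝ)‖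
    simpa using h2
  exact (h1.eventually (gt_mem_nhds zero_lt_one)).exists

theorem spectralRadius_lt_one_iff_tendsto_pow {A : Matrix n n ℝ} :
    spectralRadius ℂ (A.map (algebraMap ℝ ℂ)) < 1 ↔ Tendsto (fun k : ℕ => A ^ k) atTop (𝓝 0) :=
  ⟨tendsto_pow_of_spectralRadius_lt_one, fun h =>
    (exists_norm_pow_lt_of_tendsto_pow h).elim fun _ => spectralRadius_lt_one_of_norm_pow_lt⟩

end Matrix

/-! ### Smoothness of matrix operations -/

section ContDiffMatrix

variable {E : Type*} [NormedAddCommGroup E] [NormedSpace ℝ E] {r : WithTop ℕ∞} {x : E}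
  {l m n : Type*} [Fintype l] [Fintype m] [Fintype n]

theorem ContDiffAt.matrix_mul {f : E → Matrix l m ℝ} {g : E → Matrix m n ℝ}
    (hf : ContDiffAt ℝ r f x) (hg : ContDiffAt ℝ r g x) :
    ContDiffAt ℝ r (fun y => f y * g y) x :=
  (Matrix.isBoundedBilinearMap_mul.contDiff (n := r)).contDiffAt.comp x (hf.prodMk hg)

theorem ContDiffAt.matrix_transpose {f : E → Matrix l m ℝ} (hf : ContDiffAt ℝ r f x) :
    ContDiffAt ℝ r (fun y => (f y)ᵀ) x :=
  (LinearMap.toContinuousLinearMap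
    (Matrix.transposeLinearEquiv l m ℝ ℝ).toLinearMap).contDiff.contDiffAt.comp x hf

theorem ContDiffAt.matrix_trace {f : E → Matrix n n ℝ} (hf : ContDiffAt ℝ r f x) :
    ContDiffAt ℝ r (fun y => (f y).trace) x :=
  (LinearMap.toContinuousLinearMap (Matrix.traceLinearMap n ℝ ℝ)).contDiff.contDiffAt.comp x hf

end ContDiffMatrix

/-- Continuous linear maps between normed spaces, for the norm topologies. -/
abbrev NormedHom (E F : Type*) [NormedAddCommGroup E] [NormedSpace ℝ E] [NormedAddCommGroup F]
    [NormedSpace ℝ F] : Type _ := E →L[ℝ] F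

/-! ### The discrete Lyapunov equation -/

namespace Matrix

variable {m n : Type*} [Fintype m] [Fintype n] {A S W : Matrix n n ℝ}

/-- The linear map `S ↦ S - A S Aᵀ` whose inverse solves discrete Lyapunov equations. -/
noncomputable def lyapunovCLM (A : Matrix n n ℝ) : NormedHom (Matrix n n ℝ) (Matrix n n ℝ) :=
  LinearMap.toContinuousLinearMap
    { toFun := fun S => S - A * S * Aᵀ
      map_add' := fun S T => by simp only [Matrix.mul_add, Matrix.add_mul]; abel
      map_smul' := fun c S => by simp [smul_sub] }

@[simp]
theorem lyapunovCLM_apply (A S : Matrix n n ℝ) : lyapunovCLM A S = S - A * S * Aᵀ := rfl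

/-- The solution of `S = W + A S Aᵀ` when the powers of `A` tend to `0`. -/
noncomputable def lyapunovSol (A W : Matrix n n ℝ) : Matrix n n ℝ := (lyapunovCLM A).inverse W

theorem lyapunov_dotProduct_mulVec (h : S = W + A * S * Aᵀ) (x : n → ℝ) :
    x ⬝ᵥ S *ᵥ x = x ⬝ᵥ W *ᵥ x + (Aᵀ *ᵥ x) ⬝ᵥ S *ᵥ (Aᵀ *ᵥ x) := by
  conv_lhs => rw [h]
  rw [add_mulVec, dotProduct_add, ← mulVec_mulVec, ← mulVec_mulVec, dotProduct_mulVec _ A,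
    ← mulVec_transpose]

theorem lyapunov_trace_le (hS : S.PosSemidef) (h : S = W + A * S * Aᵀ) (M : Matrix m n ℝ) :
    (M * W * Mᵀ).trace ≤ (M * S * Mᵀ).trace := by
  conv_rhs => rw [h]
  have e : M * (W + A * S * Aᵀ) * Mᵀ = M * W * Mᵀ + (M * A) * S * (M * A)ᵀ := by
    simp only [transpose_mul, Matrix.mul_add, Matrix.add_mul, Matrix.mul_assoc]
  rw [e, trace_add]
  linarith [hS.trace_mul_mul_transpose_nonneg (M * A)]

theorem contDiff_lyapunovCLM {r : WithTop ℕ∞} :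
    ContDiff ℝ r (lyapunovCLM : Matrix n n ℝ → _) := by
  rw [contDiff_clm_apply_iff]
  intro S
  rw [contDiff_iff_contDiffAt]
  intro A
  simp only [lyapunovCLM_apply]
  exact contDiffAt_const.sub ((contDiffAt_id.matrix_mul contDiffAt_const).matrix_mul
    contDiffAt_id.matrix_transpose)

variable [DecidableEq n]

theorem lyapunov_iterate (h : S = W + A * S * Aᵀ) (k : ℕ) :
    S = ∑ i ∈ Finset.range k, A ^ i * W * (A ^ i)ᵀ + A ^ k * S * (A ^ k)ᵀ := by
  induction k with
  | zero => simp
  | succ k ih =>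
    have e : A ^ k * S * (A ^ k)ᵀ
        = A ^ k * W * (A ^ k)ᵀ + A ^ (k + 1) * S * (A ^ (k + 1))ᵀ := by
      conv_lhs => rw [h]
      simp only [pow_succ, transpose_mul, Matrix.mul_add, Matrix.add_mul, Matrix.mul_assoc]
    rw [Finset.sum_range_succ, add_assoc, ← e]
    exact ih

theorem tendsto_pow_mul_mul_pow (hA : Tendsto (fun k : ℕ => A ^ k) atTop (𝓝 0))
    (S : Matrix n n ℝ) : Tendsto (fun k : ℕ => A ^ k * S * (A ^ k)ᵀ) atTop (𝓝 0) := by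
  have h : Continuous fun X : Matrix n n ℝ => X * S * Xᵀ := by fun_prop
  simpa [Function.comp_def] using (h.tendsto 0).comp hA

/-- A kernel element satisfies `S = A ^ k * S * (A ^ k)ᵀ` for every `k`, hence is `0` in the limit;
in finite dimension injectivity suffices. -/
theorem lyapunovCLM_isInvertible (hA : Tendsto (fun k : ℕ => A ^ k) atTop (𝓝 0)) :
    (lyapunovCLM A).IsInvertible := by
  have hinj : Function.Injective (lyapunovCLM A).toLinearMap := by
    rw [← LinearMap.ker_eq_bot, LinearMap.ker_eq_bot']
    intro S hS
    have h : S = 0 + A * S * Aᵀ := by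
      rw [zero_add]
      exact sub_eq_zero.1 hS
    have h2 : ∀ k : ℕ, A ^ k * S * (A ^ k)ᵀ = S := fun k => by
      simpa using (lyapunov_iterate h k).symm
    have h3 := tendsto_pow_mul_mul_pow hA S
    simp only [h2] at h3
    exact tendsto_nhds_unique tendsto_const_nhds h3
  exact ⟨(LinearEquiv.ofInjectiveEndo _ hinj).toContinuousLinearEquiv, by ext; rfl⟩

theorem lyapunovSol_eq (hA : Tendsto (fun k : ℕ => A ^ k) atTop (𝓝 0)) (W : Matrix n n ℝ) :
    lyapunovSol A W = W + A * lyapunovSol A W * Aᵀ := by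
  have h : lyapunovCLM A (lyapunovSol A W) = W :=
    (lyapunovCLM_isInvertible hA).self_apply_inverse W
  rw [lyapunovCLM_apply] at h
  exact sub_eq_iff_eq_add.1 h

theorem eq_lyapunovSol (hA : Tendsto (fun k : ℕ => A ^ k) atTop (𝓝 0))
    (h : S = W + A * S * Aᵀ) : S = lyapunovSol A W := by
  have h1 : lyapunovCLM A S = W := by
    rw [lyapunovCLM_apply]
    exact sub_eq_iff_eq_add.2 h
  rw [lyapunovSol, ← h1]
  exact ((lyapunovCLM_isInvertible hA).inverse_apply_self S).symm

/-- Symmetry follows from uniqueness, as `Sᵀ` solves the same equation. For positivity, `S`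
dominates the remainder of its `k`-fold iteration, which tends to `0`. -/
theorem PosSemidef.lyapunovSol (hW : W.PosSemidef)
    (hA : Tendsto (fun k : ℕ => A ^ k) atTop (𝓝 0)) : (lyapunovSol A W).PosSemidef := by
  have hS := lyapunovSol_eq hA W
  have hWt : Wᵀ = W := hW.1
  set S := Matrix.lyapunovSol A W with hSdef
  refine .of_dotProduct_mulVec_nonneg ?_ fun x => ?_
  · have : Sᵀ = W + A * Sᵀ * Aᵀ := by
      conv_lhs => rw [hS]
      simp [hWt, Matrix.mul_assoc]
    simpa [IsHermitian] using (eq_lyapunovSol hA this)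
  · have hk (k : ℕ) : star x ⬝ᵥ (A ^ k * S * (A ^ k)ᵀ) *ᵥ x ≤ star x ⬝ᵥ S *ᵥ x := by
      conv_rhs => rw [lyapunov_iterate hS k]
      rw [add_mulVec, dotProduct_add]
      have : (∑ i ∈ Finset.range k, A ^ i * W * (A ^ i)ᵀ).PosSemidef :=
        posSemidef_sum _ fun i _ => by simpa using hW.mul_mul_conjTranspose_same (A ^ i)
      linarith [this.dotProduct_mulVec_nonneg x]
    have hc : Continuous fun X : Matrix n n ℝ => star x ⬝ᵥ X *ᵥ x := by fun_prop
    have hl := (hc.tendsto 0).comp (tendsto_pow_mul_mul_pow hA S)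
    simp only [zero_mulVec, dotProduct_zero] at hl
    exact le_of_tendsto' hl hk

/-- This turns a bound on the trace of the covariance into a bound on the powers of `A` that no
longer mentions `S`. -/
theorem lyapunov_sum_norm_sq_le (hS : S.PosSemidef) (h : S = W + A * S * Aᵀ) {c : ℝ}
    (hc : ∀ M : Matrix n n ℝ, c * ‖M‖ ^ 2 ≤ (M * W * Mᵀ).trace) (k : ℕ) :
    c * ∑ i ∈ Finset.range k, ‖A ^ i‖ ^ 2 ≤ S.trace := by
  have e := congrArg trace (lyapunov_iterate h k)
  rw [trace_add, trace_sum] at e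
  rw [Finset.mul_sum, e]
  exact (Finset.sum_le_sum fun i _ => hc _).trans
    (le_add_of_nonneg_right (hS.trace_mul_mul_transpose_nonneg _))

theorem tendsto_pow_of_sum_norm_sq_le {C : ℝ}
    (h : ∀ k, ∑ i ∈ Finset.range k, ‖A ^ i‖ ^ 2 ≤ C) :
    Tendsto (fun k : ℕ => A ^ k) atTop (𝓝 0) := by
  have h1 := (summable_of_sum_range_le (fun i => sq_nonneg ‖A ^ i‖) h).tendsto_atTop_zero
  refine tendsto_zero_iff_norm_tendsto_zero.2 ?_
  have h2 := h1.sqrt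
  simpa [Real.sqrt_sq (norm_nonneg _)] using h2

theorem eventually_tendsto_pow (hA : Tendsto (fun k : ℕ => A ^ k) atTop (𝓝 0)) :
    ∀ᶠ A' in 𝓝 A, Tendsto (fun k : ℕ => A' ^ k) atTop (𝓝 0) := by
  obtain ⟨k, hk⟩ := exists_norm_pow_lt_of_tendsto_pow hA
  have hc : Continuous fun X : Matrix n n ℝ => ‖X ^ (k + 1)‖ * ‖(1 : Matrix n n ℝ)‖ := by
    have : Continuous fun X : Matrix n n ℝ => X ^ (k + 1) := by fun_prop
    exact this.norm.mul_const _
  filter_upwards [(hc.tendsto A).eventually (gt_mem_nhds hk)] with A' hA'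
  exact spectralRadius_lt_one_iff_tendsto_pow.1 (spectralRadius_lt_one_of_norm_pow_lt hA')

theorem contDiffAt_lyapunovSol {r : WithTop ℕ∞} (hA : Tendsto (fun k : ℕ => A ^ k) atTop (𝓝 0))
    (W : Matrix n n ℝ) : ContDiffAt ℝ r (fun A' => lyapunovSol A' W) A :=
  ((lyapunovCLM_isInvertible hA).contDiffAt_map_inverse.comp A
    contDiff_lyapunovCLM.contDiffAt).clm_apply contDiffAt_const

end Matrix

/-! ### Gaussian laws, the stationary law and the risk -/

open scoped RealInnerProductSpace

theorem charFun_map_continuousLinearMap {E F : Type*} [NormedAddCommGroup E]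
    [InnerProductSpace ℝ E] [CompleteSpace E] [MeasurableSpace E] [BorelSpace E]
    [NormedAddCommGroup F] [InnerProductSpace ℝ F] [CompleteSpace F] [MeasurableSpace F]
    [BorelSpace F] [SecondCountableTopology F] (μ : Measure E) (T : E →L[ℝ] F) (t : F) :
    charFun (μ.map T) t = charFun μ (ContinuousLinearMap.adjoint T t) := by
  rw [charFun_apply, charFun_apply, integral_map (by fun_prop) (by fun_prop)]
  simp_rw [ContinuousLinearMap.adjoint_inner_right]

theorem integral_conv_real_eq {E : Type*} [AddMonoid E] [MeasurableSpace E] [MeasurableAdd₂ E]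
    (μ ν : Measure E) [IsProbabilityMeasure μ] [IsProbabilityMeasure ν] {s : Set E}
    (hs : MeasurableSet s) : (μ ∗ ν).real s = ∫ x, ν.real {y | x + y ∈ s} ∂μ := by
  have h1 : ∫ x, s.indicator (fun _ => (1 : ℝ)) x ∂(μ ∗ ν) = (μ ∗ ν).real s := integral_indicator_one hs
  rw [← h1, integral_conv ((integrable_const (1 : ℝ)).indicator hs)]
  refine integral_congr_ae (.of_forall fun x => ?_)
  have hm : MeasurableSet {y | x + y ∈ s} := (measurable_const_add x) hs
  exact integral_indicator_one (μ := ν) hm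

namespace Matrix

variable {n : ℕ}

theorem adjoint_toEuclideanCLM (A : Matrix (Fin n) (Fin n) ℝ) :
    ContinuousLinearMap.adjoint (toEuclideanCLM (𝕜 := ℝ) A) = toEuclideanCLM (𝕜 := ℝ) Aᵀ := by
  rw [← ContinuousLinearMap.star_eq_adjoint, ← map_star, star_eq_conjTranspose,
    conjTranspose_eq_transpose_of_trivial]

end Matrix

namespace RiskLQR

theorem integrable_exp_neg_sq_half : Integrable fun z : ℝ => Real.exp (-(z ^ 2) / 2) := by
  have := integrable_exp_neg_mul_sq (b := 1 / 2) (by norm_num)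
  refine this.congr (.of_forall fun z => ?_)
  show Real.exp _ = Real.exp _
  congr 1
  ring

theorem hasDerivAt_gaussianTail (a : ℝ) :
    HasDerivAt gaussianTail (1 / √(2 * Real.pi) * -Real.exp (-(a ^ 2) / 2)) a := by
  have hi := integrable_exp_neg_sq_half
  have e : gaussianTail = fun a => 1 / √(2 * Real.pi) *
      ((∫ z in Set.Ioi (0 : ℝ), Real.exp (-(z ^ 2) / 2)) -
        ∫ z in (0 : ℝ)..a, Real.exp (-(z ^ 2) / 2)) := by
    funext a
    rw [gaussianTail, ← intervalIntegral.integral_interval_add_Ioi (a := 0) (b := a)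
      hi.integrableOn hi.integrableOn, add_sub_cancel_left]
  rw [e]
  have hc : Continuous fun z : ℝ => Real.exp (-(z ^ 2) / 2) := by fun_prop
  exact ((hc.integral_hasStrictDerivAt 0 a).hasDerivAt.const_sub _).const_mul _

theorem contDiff_gaussianTail : ContDiff ℝ (⊤ : ℕ∞) gaussianTail := by
  rw [contDiff_infty_iff_deriv]
  refine ⟨fun a => (hasDerivAt_gaussianTail a).differentiableAt, ?_⟩
  rw [funext fun a => (hasDerivAt_gaussianTail a).deriv]
  fun_prop

theorem gaussianTail_nonneg (a : ℝ) : 0 ≤ gaussianTail a :=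
  mul_nonneg (by positivity) (integral_nonneg fun _ => (Real.exp_pos _).le)

theorem gaussianReal_real_Ioi (a : ℝ) : (gaussianReal 0 1).real (Set.Ioi a) = gaussianTail a := by
  rw [measureReal_def, gaussianReal_apply_eq_integral 0 one_ne_zero, ENNReal.toReal_ofReal
    (integral_nonneg fun _ => gaussianPDFReal_nonneg _ _ _), gaussianTail, ← integral_const_mul]
  simp [gaussianPDFReal]

variable {n p : ℕ}

/-- The normalized projection `qᵀ w / √(qᵀ S q)` is standard normal, by comparing characteristic
functions. -/
theorem multivariateGaussian_real_halfSpace {S : Matrix (Fin n) (Fin n) ℝ} (hS : S.PosSemidef)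
    {q : Fin n → ℝ} (hq : 0 < q ⬝ᵥ S *ᵥ q) (b : ℝ) :
    (multivariateGaussian 0 S).real {w | b < q ⬝ᵥ w.ofLp} = gaussianTail (b / √(q ⬝ᵥ S *ᵥ q)) := by
  set s := √(q ⬝ᵥ S *ᵥ q) with hs
  have hs0 : 0 < s := Real.sqrt_pos.2 hq
  have hs2 : s ^ 2 = q ⬝ᵥ S *ᵥ q := Real.sq_sqrt hq.le
  have hf : Measurable fun w : EuclideanSpace ℝ (Fin n) => (q ⬝ᵥ w.ofLp) / s := by
    unfold dotProduct; fun_prop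
  have hmap : (multivariateGaussian 0 S).map (fun w => (q ⬝ᵥ w.ofLp) / s) = gaussianReal 0 1 := by
    have : IsProbabilityMeasure
        ((multivariateGaussian 0 S).map (fun w => (q ⬝ᵥ w.ofLp) / s)) :=
      Measure.isProbabilityMeasure_map hf.aemeasurable
    refine Measure.ext_of_charFun (funext fun t => ?_)
    have e : charFun ((multivariateGaussian 0 S).map (fun w => (q ⬝ᵥ w.ofLp) / s)) t =
        charFun (multivariateGaussian 0 S) (WithLp.toLp 2 ((t / s) • q)) := by
      rw [charFun_apply, charFun_apply, integral_map hf.aemeasurable (by fun_prop)]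
      refine integral_congr_ae (.of_forall fun w => ?_)
      simp only [EuclideanSpace.inner_eq_star_dotProduct, star_trivial, smul_dotProduct,
        smul_eq_mul, RCLike.inner_apply, conj_trivial]
      congr 3
      ring
    rw [e, charFun_multivariateGaussian hS, charFun_gaussianReal]
    simp only [inner_zero_right, Matrix.mulVec_smul, smul_dotProduct, dotProduct_smul, ← hs2, smul_eq_mul]
    congr 1
    have : t / s * (t / s * s ^ 2) = t ^ 2 := by field_simp
    rw [this]
    simp
  rw [← gaussianReal_real_Ioi, ← hmap, map_measureReal_apply hf measurableSet_Ioi]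
  congr 1
  ext w
  simp [div_lt_div_iff_of_pos_right hs0]

variable (P : RiskLQR n p) {K : Matrix (Fin p) (Fin n) ℝ} {S : Matrix (Fin n) (Fin n) ℝ}

theorem isStationaryLaw_multivariateGaussian (hW : P.noiseCov.PosSemidef) (hS : S.PosSemidef)
    (h : S = P.noiseCov + P.closedLoop K * S * (P.closedLoop K)ᵀ) :
    P.IsStationaryLaw K (multivariateGaussian 0 S) := by
  refine ⟨inferInstance, ?_⟩
  have : IsProbabilityMeasure ((multivariateGaussian 0 S).map
      (Matrix.toEuclideanCLM (𝕜 := ℝ) (P.closedLoop K))) :=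
    Measure.isProbabilityMeasure_map (by fun_prop)
  refine Measure.ext_of_charFun (funext fun t => ?_)
  rw [charFun_conv, charFun_map_continuousLinearMap, Matrix.adjoint_toEuclideanCLM,
    charFun_multivariateGaussian hS, charFun_multivariateGaussian hS,
    charFun_multivariateGaussian hW, ← Complex.exp_add]
  congr 1
  rw [Matrix.lyapunov_dotProduct_mulVec h t.ofLp]
  simp only [inner_zero_right, Matrix.ofLp_toEuclideanCLM]
  push_cast
  ring

/-- Iterating stationarity moves the argument of both characteristic functions to `(A ^ k)ᵀ t → 0`,
where both tend to `1`. -/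
theorem IsStationaryLaw.unique (hA : Tendsto (fun k : ℕ => P.closedLoop K ^ k) atTop (𝓝 0))
    {μ ν : Measure (EuclideanSpace ℝ (Fin n))}
    (hμ : P.IsStationaryLaw K μ) (hν : P.IsStationaryLaw K ν) : μ = ν := by
  set A := P.closedLoop K with hAdef
  have hμ1 := hμ.1
  have hν1 := hν.1
  have step {ρ : Measure (EuclideanSpace ℝ (Fin n))} (hρ : P.IsStationaryLaw K ρ)
      (t : EuclideanSpace ℝ (Fin n)) :
      charFun ρ t = charFun ρ (Matrix.toEuclideanCLM (𝕜 := ℝ) Aᵀ t) *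
        charFun (multivariateGaussian 0 P.noiseCov) t := by
    have := hρ.1
    have : IsProbabilityMeasure (ρ.map (Matrix.toEuclideanCLM (𝕜 := ℝ) A)) :=
      Measure.isProbabilityMeasure_map (by fun_prop)
    conv_lhs => rw [← hρ.2]
    rw [charFun_conv, charFun_map_continuousLinearMap, Matrix.adjoint_toEuclideanCLM]
  -- The factor `c` collects noise characteristic functions only, so the same one serves `μ` and
  -- `ν`.
  have iter (k : ℕ) (t : EuclideanSpace ℝ (Fin n)) : ∃ c : ℂ,
      charFun μ t = charFun μ (Matrix.toEuclideanCLM (𝕜 := ℝ) ((A ^ k)ᵀ) t) * c ∧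
      charFun ν t = charFun ν (Matrix.toEuclideanCLM (𝕜 := ℝ) ((A ^ k)ᵀ) t) * c ∧ ‖c‖ ≤ 1 := by
    induction k generalizing t with
    | zero => exact ⟨1, by simp, by simp, by simp⟩
    | succ k ih =>
      obtain ⟨c, h1, h2, h3⟩ := ih (Matrix.toEuclideanCLM (𝕜 := ℝ) Aᵀ t)
      refine ⟨c * charFun (multivariateGaussian 0 P.noiseCov) t, ?_, ?_, ?_⟩
      · rw [step hμ, h1, pow_succ', Matrix.transpose_mul, map_mul, mul_assoc]
        rfl
      · rw [step hν, h2, pow_succ', Matrix.transpose_mul, map_mul, mul_assoc]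
        rfl
      · rw [norm_mul]
        exact mul_le_one₀ h3 (norm_nonneg _) (norm_charFun_le_one _)
  refine Measure.ext_of_charFun (funext fun t => ?_)
  have hlim : Tendsto (fun k : ℕ => Matrix.toEuclideanCLM (𝕜 := ℝ) ((A ^ k)ᵀ) t) atTop (𝓝 0) := by
    have hc : Continuous fun X : Matrix (Fin n) (Fin n) ℝ => WithLp.toLp 2 (Xᵀ *ᵥ t.ofLp) := by
      fun_prop
    have h0 := (hc.tendsto 0).comp hA
    rwa [Matrix.transpose_zero, Matrix.zero_mulVec, WithLp.toLp_zero] at h0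
  have hμl := (continuous_charFun (μ := μ)).tendsto 0 |>.comp hlim
  have hνl := (continuous_charFun (μ := ν)).tendsto 0 |>.comp hlim
  have hd := (hμl.sub hνl).norm
  simp only [charFun_zero, probReal_univ, sub_self, norm_zero] at hd
  have : ‖charFun μ t - charFun ν t‖ ≤ 0 := by
    refine ge_of_tendsto' hd fun k => ?_
    obtain ⟨c, h1, h2, h3⟩ := iter k t
    rw [h1, h2, ← sub_mul, norm_mul]
    exact mul_le_of_le_one_right (norm_nonneg _) h3
  exact sub_eq_zero.1 (norm_le_zero_iff.1 this)

theorem stationaryLaw_eq (hA : Tendsto (fun k : ℕ => P.closedLoop K ^ k) atTop (𝓝 0))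
    (hW : P.noiseCov.PosSemidef) (hS : S.PosSemidef)
    (h : S = P.noiseCov + P.closedLoop K * S * (P.closedLoop K)ᵀ) :
    P.stationaryLaw K = multivariateGaussian 0 S := by
  have hex : ∃ μ, P.IsStationaryLaw K μ :=
    ⟨_, P.isStationaryLaw_multivariateGaussian hW hS h⟩
  rw [stationaryLaw, dif_pos hex]
  exact IsStationaryLaw.unique P hA hex.choose_spec
    (P.isStationaryLaw_multivariateGaussian hW hS h)

theorem risk_eq_gaussianTail (hA : Tendsto (fun k : ℕ => P.closedLoop K ^ k) atTop (𝓝 0))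
    (hW : P.noiseCov.PosDef) (hq : P.q ≠ 0) (hS : S.PosSemidef)
    (h : S = P.noiseCov + P.closedLoop K * S * (P.closedLoop K)ᵀ)
    (hSq : 0 < P.q ⬝ᵥ S *ᵥ P.q) :
    P.risk K = gaussianTail (P.ε / √(P.q ⬝ᵥ S *ᵥ P.q)) := by
  have hWq : 0 < P.q ⬝ᵥ P.noiseCov *ᵥ P.q := by simpa using hW.dotProduct_mulVec_pos hq
  have hcont : Continuous fun y : EuclideanSpace ℝ (Fin n) =>
      gaussianTail ((P.ε - P.q ⬝ᵥ y.ofLp) / √(P.q ⬝ᵥ P.noiseCov *ᵥ P.q)) := by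
    have h1 : Continuous fun y : EuclideanSpace ℝ (Fin n) => P.q ⬝ᵥ y.ofLp := by fun_prop
    exact contDiff_gaussianTail.continuous.comp ((continuous_const.sub h1).div_const _)
  have hmeas : MeasurableSet {w : EuclideanSpace ℝ (Fin n) | P.ε < P.q ⬝ᵥ w.ofLp} :=
    measurableSet_lt measurable_const (by unfold dotProduct; fun_prop)
  have : IsProbabilityMeasure ((multivariateGaussian 0 S).map
      (Matrix.toEuclideanCLM (𝕜 := ℝ) (P.closedLoop K))) :=
    Measure.isProbabilityMeasure_map (by fun_prop)
  -- Stationarity rewrites `N(0, S)` as the law of `A_K x + w̄`; conditioning on `x` then recovers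
  -- the integrand of the risk.
  rw [← multivariateGaussian_real_halfSpace hS hSq,
    ← (P.isStationaryLaw_multivariateGaussian hW.posSemidef hS h).2,
    integral_conv_real_eq _ _ hmeas]
  have e (y : EuclideanSpace ℝ (Fin n)) : (multivariateGaussian 0 P.noiseCov).real
      {w | y + w ∈ {w : EuclideanSpace ℝ (Fin n) | P.ε < P.q ⬝ᵥ w.ofLp}} =
      gaussianTail ((P.ε - P.q ⬝ᵥ y.ofLp) / √(P.q ⬝ᵥ P.noiseCov *ᵥ P.q)) := by
    rw [← multivariateGaussian_real_halfSpace hW.posSemidef hWq]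
    congr 1
    ext w
    simp [sub_lt_iff_lt_add']
  simp_rw [e]
  rw [integral_map (by fun_prop) hcont.aestronglyMeasurable, risk,
    P.stationaryLaw_eq hA hW.posSemidef hS h]
  rfl

end RiskLQR

/-- With `S = D Dᵀ`, both traces are quadratic in `M * D`, and the Frobenius bound for `Q` applies
to its transpose. -/
theorem Matrix.PosDef.exists_le_trace_transpose_mul_mul {m : Type*} [Fintype m]
    {Q : Matrix m m ℝ} (hQ : Q.PosDef) {n : Type*} [Fintype n] :
    ∃ c : ℝ, 0 < c ∧ ∀ (M : Matrix m n ℝ) (S : Matrix n n ℝ), S.PosSemidef →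
      c * (M * S * Mᵀ).trace ≤ (Mᵀ * Q * M * S).trace := by
  obtain ⟨c, hc, h⟩ := hQ.exists_le_trace_mul_mul_transpose (m := n)
  refine ⟨c, hc, fun M S hS => ?_⟩
  obtain ⟨D, rfl⟩ := hS.exists_eq_mul_transpose
  have e1 : M * (D * Dᵀ) * Mᵀ = (M * D) * (M * D)ᵀ := by
    simp only [Matrix.transpose_mul, Matrix.mul_assoc]
  have e2 : (Mᵀ * Q * M * (D * Dᵀ)).trace = ((M * D)ᵀ * Q * ((M * D)ᵀ)ᵀ).trace := by
    rw [← Matrix.mul_assoc, Matrix.trace_mul_comm]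
    simp only [Matrix.transpose_mul, Matrix.transpose_transpose, Matrix.mul_assoc]
  rw [e1, e2, ← Matrix.frobenius_norm_sq_eq_trace, ← Matrix.frobenius_norm_transpose (M * D)]
  exact h _

/-! ### Regularity and coercivity of the Lagrangian; compact sublevel sets -/

namespace RiskLQR

variable {n p : ℕ} (P : RiskLQR n p) {K : Matrix (Fin p) (Fin n) ℝ}

theorem mem_stabilizing_iff :
    K ∈ P.stabilizing ↔ Tendsto (fun k : ℕ => P.closedLoop K ^ k) atTop (𝓝 0) :=
  Matrix.spectralRadius_lt_one_iff_tendsto_pow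

theorem contDiff_closedLoop {r : WithTop ℕ∞} : ContDiff ℝ r P.closedLoop :=
  contDiff_iff_contDiffAt.2 fun _ =>
    contDiffAt_const.sub (contDiffAt_const.matrix_mul contDiffAt_id)

theorem isOpen_stabilizing : IsOpen P.stabilizing := by
  refine isOpen_iff_eventually.2 fun K hK => ?_
  have h := Matrix.eventually_tendsto_pow (P.mem_stabilizing_iff.1 hK)
  have hc : Continuous P.closedLoop := P.contDiff_closedLoop (r := 0).continuous
  filter_upwards [(hc.tendsto K).eventually h] with K' hK'
  exact P.mem_stabilizing_iff.2 hK'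

/-- The stationary covariance as a smooth function of a stabilizing gain. -/
noncomputable def covSol (K : Matrix (Fin p) (Fin n) ℝ) : Matrix (Fin n) (Fin n) ℝ :=
  Matrix.lyapunovSol (P.closedLoop K) P.noiseCov

theorem covSol_eq (hK : K ∈ P.stabilizing) :
    P.covSol K = P.noiseCov + P.closedLoop K * P.covSol K * (P.closedLoop K)ᵀ :=
  Matrix.lyapunovSol_eq (P.mem_stabilizing_iff.1 hK) _

theorem stateCov_eq_covSol (hK : K ∈ P.stabilizing) : P.stateCov K = P.covSol K := by
  have hex : ∃ S, S = P.noiseCov + P.closedLoop K * S * (P.closedLoop K)ᵀ := ⟨_, P.covSol_eq hK⟩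
  rw [stateCov, dif_pos hex]
  exact Matrix.eq_lyapunovSol (P.mem_stabilizing_iff.1 hK) hex.choose_spec

theorem posSemidef_covSol (hW : P.noiseCov.PosDef) (hK : K ∈ P.stabilizing) :
    (P.covSol K).PosSemidef :=
  hW.posSemidef.lyapunovSol (P.mem_stabilizing_iff.1 hK)

theorem contDiffAt_covSol {r : WithTop ℕ∞} (hK : K ∈ P.stabilizing) :
    ContDiffAt ℝ r P.covSol K :=
  (Matrix.contDiffAt_lyapunovSol (P.mem_stabilizing_iff.1 hK) P.noiseCov).comp K
    P.contDiff_closedLoop.contDiffAt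

theorem dotProduct_covSol_pos (hW : P.noiseCov.PosDef) (hq : P.q ≠ 0) (hK : K ∈ P.stabilizing) :
    0 < P.q ⬝ᵥ P.covSol K *ᵥ P.q := by
  have hWq : 0 < P.q ⬝ᵥ P.noiseCov *ᵥ P.q := by simpa using hW.dotProduct_mulVec_pos hq
  have h := (P.posSemidef_covSol hW hK).dotProduct_mulVec_nonneg ((P.closedLoop K)ᵀ *ᵥ P.q)
  rw [star_trivial] at h
  rw [Matrix.lyapunov_dotProduct_mulVec (P.covSol_eq hK) P.q]
  linarith

theorem risk_eq (hW : P.noiseCov.PosDef) (hq : P.q ≠ 0) (hK : K ∈ P.stabilizing) :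
    P.risk K = gaussianTail (P.ε / √(P.q ⬝ᵥ P.covSol K *ᵥ P.q)) :=
  P.risk_eq_gaussianTail (P.mem_stabilizing_iff.1 hK) hW hq (P.posSemidef_covSol hW hK)
    (P.covSol_eq hK) (P.dotProduct_covSol_pos hW hq hK)

theorem contDiffAt_risk (hW : P.noiseCov.PosDef) (hq : P.q ≠ 0) (hK : K ∈ P.stabilizing) :
    ContDiffAt ℝ (⊤ : ℕ∞) P.risk K := by
  have hev : P.risk =ᶠ[𝓝 K] fun K => gaussianTail (P.ε / √(P.q ⬝ᵥ P.covSol K *ᵥ P.q)) := by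
    filter_upwards [P.isOpen_stabilizing.mem_nhds hK] with K' hK' using P.risk_eq hW hq hK'
  have hlin : ContDiff ℝ (⊤ : ℕ∞) fun S : Matrix (Fin n) (Fin n) ℝ => P.q ⬝ᵥ S *ᵥ P.q :=
    (LinearMap.toContinuousLinearMap
      { toFun := fun S : Matrix (Fin n) (Fin n) ℝ => P.q ⬝ᵥ S *ᵥ P.q
        map_add' := fun S T => by simp [Matrix.add_mulVec]
        map_smul' := fun c S => by simp [Matrix.smul_mulVec] }).contDiff
  have hpos := P.dotProduct_covSol_pos hW hq hK
  have hquad : ContDiffAt ℝ (⊤ : ℕ∞) (fun K => P.q ⬝ᵥ P.covSol K *ᵥ P.q) K :=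
    hlin.contDiffAt.comp K (P.contDiffAt_covSol hK)
  exact (contDiff_gaussianTail.contDiffAt.comp K (contDiffAt_const.div (hquad.sqrt hpos.ne')
    (Real.sqrt_pos.2 hpos).ne')).congr_of_eventuallyEq hev

theorem contDiffAt_cost (hK : K ∈ P.stabilizing) : ContDiffAt ℝ (⊤ : ℕ∞) P.cost K := by
  have hev : P.cost =ᶠ[𝓝 K] fun K =>
      ((P.Q + Kᵀ * P.R * K) * P.covSol K).trace + (P.R * P.Su).trace := by
    filter_upwards [P.isOpen_stabilizing.mem_nhds hK] with K' hK'
    rw [cost, P.stateCov_eq_covSol hK']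
  have hid : ContDiffAt ℝ (⊤ : ℕ∞) (fun K : Matrix (Fin p) (Fin n) ℝ => K) K := contDiffAt_id
  refine ContDiffAt.congr_of_eventuallyEq ?_ hev
  exact (((contDiffAt_const.add ((hid.matrix_transpose.matrix_mul contDiffAt_const).matrix_mul
    hid)).matrix_mul (P.contDiffAt_covSol hK)).matrix_trace).add contDiffAt_const

theorem contDiffAt_lagrangian (hW : P.noiseCov.PosDef) (hq : P.q ≠ 0) (lam : ℝ)
    (hK : K ∈ P.stabilizing) : ContDiffAt ℝ (⊤ : ℕ∞) (P.lagrangian lam) K :=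
  (P.contDiffAt_cost hK).add
    (contDiffAt_const.mul ((P.contDiffAt_risk hW hq hK).sub contDiffAt_const))

/-- The `Q` term controls `tr Σ_K`; the `R` term controls `tr (K Σ_K Kᵀ)`, which controls `‖K‖²`
because `Σ_K` dominates the definite matrix `W`. -/
theorem exists_le_cost (hQ : P.Q.PosDef) (hR : P.R.PosDef) (hW : P.noiseCov.PosDef) :
    ∃ a b : ℝ, 0 < a ∧ 0 < b ∧ ∀ K ∈ P.stabilizing,
      a * (P.covSol K).trace + b * ‖K‖ ^ 2 + (P.R * P.Su).trace ≤ P.cost K := by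
  obtain ⟨a, ha, hQa⟩ := hQ.exists_le_trace_transpose_mul_mul (n := Fin n)
  obtain ⟨r, hr, hRr⟩ := hR.exists_le_trace_transpose_mul_mul (n := Fin n)
  obtain ⟨w, hw, hWw⟩ := hW.exists_le_trace_mul_mul_transpose (m := Fin p)
  refine ⟨a, r * w, ha, mul_pos hr hw, fun K hK => ?_⟩
  have hS := P.posSemidef_covSol hW hK
  have h1 := hQa 1 _ hS
  simp only [Matrix.one_mul, Matrix.mul_one, Matrix.transpose_one] at h1
  have h2 : r * w * ‖K‖ ^ 2 ≤ r * (K * P.covSol K * Kᵀ).trace := by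
    rw [mul_assoc]
    exact mul_le_mul_of_nonneg_left
      ((hWw K).trans (Matrix.lyapunov_trace_le hS (P.covSol_eq hK) K)) hr.le
  rw [cost, P.stateCov_eq_covSol hK, Matrix.add_mul, Matrix.trace_add]
  linarith [hRr K _ hS]

/-- Sublevel sets lie in a compact set of gains with uniformly square-summable closed-loop
powers, all of which are stabilizing. -/
theorem exists_isCompact_sublevel_subset (hQ : P.Q.PosDef) (hR : P.R.PosDef)
    (hW : P.noiseCov.PosDef) (hq : P.q ≠ 0) {lam : ℝ} (hlam : 0 < lam) (ζ : ℝ) :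
    ∃ Z : Set (Matrix (Fin p) (Fin n) ℝ), IsCompact Z ∧ Z ⊆ P.stabilizing ∧
      P.sublevel lam ζ ⊆ Z := by
  obtain ⟨a, b, ha, hb, hcost⟩ := P.exists_le_cost hQ hR hW
  obtain ⟨w, hw, hWw⟩ := hW.exists_le_trace_mul_mul_transpose (m := Fin n)
  -- The bound left for `a tr Σ_K + b ‖K‖²` once the nonnegative risk is dropped.
  set C := ζ + lam * P.δ - (P.R * P.Su).trace with hC
  have : ProperSpace (Matrix (Fin p) (Fin n) ℝ) := FiniteDimensional.proper ℝ _
  have hcl : Continuous P.closedLoop := P.contDiff_closedLoop (r := 0).continuous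
  refine ⟨Metric.closedBall 0 (√(C / b)) ∩
    {K | ∀ k, ∑ i ∈ Finset.range k, ‖P.closedLoop K ^ i‖ ^ 2 ≤ C / a / w}, ?_, ?_, ?_⟩
  · refine (isCompact_closedBall _ _).inter_right ?_
    simp only [Set.ofPred_forall]
    refine isClosed_iInter fun k => isClosed_le ?_ continuous_const
    refine continuous_finsetSum _ fun i _ => ?_
    have : Continuous fun K => P.closedLoop K ^ i := hcl.pow i
    exact this.norm.pow 2
  · exact fun K hK => P.mem_stabilizing_iff.2 (Matrix.tendsto_pow_of_sum_norm_sq_le hK.2)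
  · rintro K ⟨hK, hL⟩
    have hS := P.posSemidef_covSol hW hK
    have hrisk : 0 ≤ P.risk K := by
      rw [P.risk_eq hW hq hK]
      exact gaussianTail_nonneg _
    have htr : 0 ≤ (P.covSol K).trace := hS.trace_nonneg
    have hsum : a * (P.covSol K).trace + b * ‖K‖ ^ 2 ≤ C := by
      have := hcost K hK
      rw [lagrangian] at hL
      nlinarith [mul_nonneg hlam.le hrisk]
    constructor
    · rw [mem_closedBall_zero_iff]
      refine Real.le_sqrt_of_sq_le ((le_div_iff₀' hb).2 ?_)
      nlinarith [mul_nonneg ha.le htr]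
    · intro k
      rw [le_div_iff₀' hw]
      refine (Matrix.lyapunov_sum_norm_sq_le hS (P.covSol_eq hK) hWw k).trans
        ((le_div_iff₀' ha).2 ?_)
      nlinarith [mul_nonneg hb.le (sq_nonneg ‖K‖)]

theorem isCompact_sublevel (hQ : P.Q.PosDef) (hR : P.R.PosDef)
    (hW : P.noiseCov.PosDef) (hq : P.q ≠ 0) {lam : ℝ} (hlam : 0 < lam) (ζ : ℝ) :
    IsCompact (P.sublevel lam ζ) := by
  obtain ⟨Z, hZ, hZs, hsub⟩ := P.exists_isCompact_sublevel_subset hQ hR hW hq hlam ζ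
  have e : P.sublevel lam ζ = Z ∩ P.lagrangian lam ⁻¹' Set.Iic ζ :=
    Set.ext fun K => ⟨fun h => ⟨hsub h, h.2⟩, fun h => ⟨hZs h.1, h.2⟩⟩
  have hc : ContinuousOn (P.lagrangian lam) Z := fun K hK =>
    (P.contDiffAt_lagrangian hW hq lam (hZs hK)).continuousAt.continuousWithinAt
  rw [e]
  exact hZ.of_isClosed_subset (hc.preimage_isClosed_of_isClosed hZ.isClosed isClosed_Iic)
    Set.inter_subset_left

end RiskLQR

/-! ### Lipschitz derivative and Taylor bound on a compact set -/

section Smooth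

open scoped Manifold ContDiff

variable {E : Type*} [NormedAddCommGroup E] [NormedSpace ℝ E]

/-- First-order Taylor estimate with the Lipschitz constant of the derivative. -/
theorem abs_sub_sub_fderiv_le_of_lipschitzWith {g : E → ℝ} (hg : Differentiable ℝ g)
    {C : NNReal} (hC : LipschitzWith C (fderiv ℝ g)) (x y : E) :
    |g y - g x - fderiv ℝ g x (y - x)| ≤ C * ‖y - x‖ ^ 2 := by
  have h := (convex_segment x y).norm_image_sub_le_of_norm_fderiv_le' (𝕜 := ℝ) (f := g)
    (φ := fderiv ℝ g x) (C := C * ‖y - x‖) (fun z _ => hg z) (fun z hz => ?_)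
    (left_mem_segment ℝ x y) (right_mem_segment ℝ x y)
  · rw [Real.norm_eq_abs] at h
    rw [sq, ← mul_assoc]
    exact h
  · refine (hC.norm_sub_le z x).trans ?_
    gcongr
    exact norm_sub_le_of_mem_segment hz

variable [FiniteDimensional ℝ E]

/-- A function that is `C^r` near a compact set agrees near that set with a compactly supported
`C^r` function. -/
theorem IsCompact.exists_contDiff_hasCompactSupport_eventuallyEq {f : E → ℝ} {U S : Set E}
    {r : ℕ∞} (hU : IsOpen U) (hf : ∀ x ∈ U, ContDiffAt ℝ r f x) (hS : IsCompact S) (hSU : S ⊆ U) :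
    ∃ g : E → ℝ, ContDiff ℝ r g ∧ HasCompactSupport g ∧ ∀ x ∈ S, g =ᶠ[𝓝 x] f := by
  obtain ⟨L, hL, hSL, hLU⟩ := exists_compact_between hS hU hSU
  obtain ⟨χ, h1, h0, -⟩ := exists_contMDiffMap_one_nhds_of_subset_interior (n := r) 𝓘(ℝ, E)
    hS.isClosed hSL
  have hχ : ContDiff ℝ r χ := χ.contMDiff.contDiff
  refine ⟨fun x => χ x * f x, contDiff_iff_contDiffAt.2 fun x => ?_, ?_, fun x hx => ?_⟩
  · by_cases hx : x ∈ U
    · exact hχ.contDiffAt.mul (hf x hx)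
    -- Nothing is known of `f` off `U`, but the cutoff vanishes near such a point.
    · have hxL : Lᶜ ∈ 𝓝 x := hL.isClosed.isOpen_compl.mem_nhds fun h => hx (hLU h)
      refine (contDiffAt_const (c := (0 : ℝ))).congr_of_eventuallyEq ?_
      filter_upwards [hxL] with y hy
      rw [h0 y hy, zero_mul]
  · exact HasCompactSupport.intro hL fun x hx => by rw [h0 x hx, zero_mul]
  · filter_upwards [Filter.Eventually.filter_mono (nhds_le_nhdsSet hx) h1] with y hy
    rw [hy, one_mul]

theorem IsCompact.exists_fderiv_lipschitz_taylor {f : E → ℝ} {U S : Set E} (hU : IsOpen U)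
    (hf : ∀ x ∈ U, ContDiffAt ℝ 2 f x) (hS : IsCompact S) (hSU : S ⊆ U) :
    ∃ C : ℝ, 0 ≤ C ∧ ∀ x ∈ S, ∀ y ∈ S, ‖fderiv ℝ f y - fderiv ℝ f x‖ ≤ C * ‖y - x‖ ∧
      f y - f x ≤ fderiv ℝ f x (y - x) + C * ‖y - x‖ ^ 2 := by
  obtain ⟨g, hg, hgs, hfg⟩ :=
    hS.exists_contDiff_hasCompactSupport_eventuallyEq (r := 2) hU hf hSU
  obtain ⟨C, hC⟩ := ContDiff.lipschitzWith_of_hasCompactSupport (𝕂 := ℝ) (hgs.fderiv ℝ)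
    (hg.fderiv_right (m := 1) (by norm_num)) one_ne_zero
  refine ⟨C, C.2, fun x hx y hy => ?_⟩
  have hT := abs_sub_sub_fderiv_le_of_lipschitzWith (hg.differentiable (by norm_num)) hC x y
  have hN := hC.norm_sub_le y x
  rw [(hfg x hx).fderiv_eq, (hfg y hy).fderiv_eq] at hN
  rw [(hfg x hx).fderiv_eq, (hfg x hx).eq_of_nhds, (hfg y hy).eq_of_nhds] at hT
  exact ⟨hN, by linarith [(abs_le.1 hT).2]⟩

end Smooth

/-! ### From derivatives to gradient matrices -/

section Gradient

variable {n p : ℕ}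

/-- The matrix representing a linear functional for the trace pairing. -/
noncomputable def traceDual (φ : NormedHom (Matrix (Fin p) (Fin n) ℝ) ℝ) : Matrix (Fin p) (Fin n) ℝ :=
  Matrix.of fun i j => φ (Matrix.single i j 1)

theorem trace_traceDual_transpose_mul (φ : NormedHom (Matrix (Fin p) (Fin n) ℝ) ℝ)
    (H : Matrix (Fin p) (Fin n) ℝ) : ((traceDual φ)ᵀ * H).trace = φ H := by
  conv_rhs => rw [Matrix.matrix_eq_sum_single H]
  have e (i : Fin p) (j : Fin n) :
      Matrix.single i j (H i j) = H i j • Matrix.single i j (1 : ℝ) := by simp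
  simp only [e, map_sum, map_smul, smul_eq_mul]
  simp only [Matrix.trace, Matrix.diag, Matrix.mul_apply, Matrix.transpose_apply, traceDual,
    Matrix.of_apply]
  rw [Finset.sum_comm]
  simp only [mul_comm]

/-- Testing `φ` on its own dual matrix gives `‖traceDual φ‖² = φ (traceDual φ) ≤ ‖φ‖ * ‖traceDual
φ‖`. -/
theorem norm_traceDual_le (φ : NormedHom (Matrix (Fin p) (Fin n) ℝ) ℝ) :
    ‖traceDual φ‖ ≤ ‖φ‖ := by
  have h : ‖traceDual φ‖ ^ 2 ≤ ‖φ‖ * ‖traceDual φ‖ := by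
    rw [Matrix.frobenius_norm_sq_eq_trace, Matrix.trace_mul_comm, trace_traceDual_transpose_mul]
    exact (le_abs_self _).trans (φ.le_opNorm _)
  by_contra! hlt
  nlinarith [norm_nonneg φ]

theorem gradMatrix_eq_traceDual (f : Matrix (Fin p) (Fin n) ℝ → ℝ)
    (K : Matrix (Fin p) (Fin n) ℝ) : gradMatrix f K = traceDual (fderiv ℝ f K) := rfl

theorem traceDual_sub (φ ψ : NormedHom (Matrix (Fin p) (Fin n) ℝ) ℝ) :
    traceDual φ - traceDual ψ = traceDual (φ - ψ) := rfl

theorem IsCompact.exists_LSmoothOn {f : Matrix (Fin p) (Fin n) ℝ → ℝ}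
    {U S : Set (Matrix (Fin p) (Fin n) ℝ)} (hU : IsOpen U)
    (hf : ∀ K ∈ U, ContDiffAt ℝ 2 f K) (hS : IsCompact S) (hSU : S ⊆ U) :
    ∃ L : ℝ, 0 < L ∧ LSmoothOn L f S := by
  obtain ⟨C, hC, h⟩ := hS.exists_fderiv_lipschitz_taylor hU hf hSU
  -- The Taylor estimate has constant `C` rather than `C / 2`, hence the doubling; the `1` ensures
  -- positivity when `C = 0`.
  refine ⟨2 * C + 1, by positivity, ⟨fun K hK => (hf K (hSU hK)).differentiableAt (by norm_num),
    fun K hK K' hK' => ?_, fun K hK K' hK' => ?_⟩⟩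
  · rw [gradMatrix_eq_traceDual, gradMatrix_eq_traceDual, traceDual_sub]
    refine (norm_traceDual_le _).trans ((h K hK K' hK').1.trans ?_)
    gcongr
    linarith
  · rw [gradMatrix_eq_traceDual, trace_traceDual_transpose_mul]
    refine (h K hK K' hK').2.trans ?_
    gcongr
    linarith

end Gradient

theorem lemma3 {n p : ℕ} (P : RiskLQR n p)
    (hQ : P.Q.PosDef) (hR : P.R.PosDef)
    (hSw : P.Sw.PosSemidef) (hSu : P.Su.PosSemidef) (hS : P.noiseCov.PosDef)
    (hstab : P.stabilizing.Nonempty)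
    (hq : P.q ≠ 0) (hε : 0 < P.ε) (hδ : 0 < P.δ)
    (lam : ℝ) (hlam : 0 < lam) (ζ : ℝ) :
    IsCompact (P.sublevel lam ζ) ∧
      ∃ L : ℝ, 0 < L ∧ LSmoothOn L (P.lagrangian lam) (P.sublevel lam ζ) := by
  have hcomp := P.isCompact_sublevel hQ hR hS hq hlam ζ
  exact ⟨hcomp, hcomp.exists_LSmoothOn P.isOpen_stabilizing
    (fun K hK => (P.contDiffAt_lagrangian hS hq lam hK).of_le (WithTop.coe_le_coe.2 (le_top : (2 : ℕ∞) ≤ ⊤)))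
    fun K hK => hK.1⟩
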